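/- Let $\mathscr A$ be a $W^*$-algebra (a $C^*$-algebra, necessarily unital, that is isometrically the dual of a Banach space). Hilbert $\mathscr A$-modules are complete right modules whose $\mathscr A$-valued inner product $\langle\cdot,\cdot\rangle$ is $\mathscr A$-linear in the second variable, $\langle x,ya\rangle=\langle x,y\rangle a$, and whose norm is $\|x\|=\|\langle x,x\rangle\|^{1/2}$; put $|x|=\langle x,x\rangle^{1/2}\in\mathscr A$. Such a module $\mathscr X$ is self-dual if every bounded $\mathscr A$-linear map $\tau:\mathscr X\to\mathscr A$ is of the form $\tau=\langle z,\cdot\rangle$ for some $z\in\mathscr X$. Let $\mathcal{PS}(\mathscr A)$ be the set of pure states of $\mathscr A$. Let $\mathscr X$ and $\mathscr Y$ be self-dual Hilbert $\mathscr A$-modules and let $B:\mathscr X\times\mathscr Y\to\mathscr A$ be a bounded $\mathscr A$-sesquilinear form, that is, $B$ is additive in each variable, $B(xa,y)=a^*B(x,y)$ and $B(x,ya)=B(x,y)a$ for all $x\in\mathscr X$, $y\in\mathscr Y$, $a\in\mathscr A$, and $\|B(x,y)\|\le M\|x\|\,\|y\|$ for some constant $M$ and all $x,y$. Suppose that there are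 constants $c>0$ and $k>0$ such that 1. for every $f\in\mathcal{PS}(\mathscr A)$ and every $x\in\mathscr X$ there is $y\in\mathscr Y$ with $\|y\|=1$, $f(|y|)\ge k$ and $|f(B(x,y))|\ge c\,f(|x|)\,f(|y|)$; 2. for every $f\in\mathcal{PS}(\mathscr A)$ and every $y\in\mathscr Y$ there is $x\in\mathscr X$ with $\|x\|=1$, $f(|x|)\ge k$ and $|f(B(x,y))|\ge c\,f(|x|)\,f(|y|)$. Then there is a bounded, adjointable, invertible $\mathscr A$-linear operator $T:\mathscr X\to\mathscr Y$ (its inverse being bounded as well) such that $B(x,y)=\langle Tx,y\rangle$ for all $x\in\mathscr X$ and $y\in\mathscr Y$. -/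

import Mathlib

open MulOpposite
open scoped ComplexOrder

/-! Right Hilbert modules over a C⋆-algebra `A`.

Mathlib's class `CStarModule R E` takes `R` to act on `E` from the left, with
`inner R x (r • y) = r * inner R x y`. A right Hilbert `A`-module is therefore the same thing as a
`CStarModule` over the opposite algebra `Aᵐᵒᵖ`: the right action is `y · a = op a • y`, and the
`A`-valued inner product is the one below. The lemmas following it are its usual axioms. -/

namespace LaxMilgram

section Defs

variable (A : Type*) [CStarAlgebra A] [PartialOrder A]
variable {X Y : Type*}
  [NormedAddCommGroup X] [NormedSpace ℂ X] [Module Aᵐᵒᵖ X] [CStarModule Aᵐᵒᵖ X]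
  [NormedAddCommGroup Y] [NormedSpace ℂ Y] [Module Aᵐᵒᵖ Y] [CStarModule Aᵐᵒᵖ Y]

/-- The `A`-valued inner product `⟨x, y⟩` of a right Hilbert `A`-module, `A`-linear in `y`. -/
def ainner (x y : X) : A := unop (inner Aᵐᵒᵖ x y)

theorem ainner_add_right (x y z : X) : ainner A x (y + z) = ainner A x y + ainner A x z := by
  simp [ainner]

theorem ainner_smul_right (a : A) (x y : X) : ainner A x (op a • y) = ainner A x y * a := by
  simp [ainner]

theorem ainner_smul_right_complex (z : ℂ) (x y : X) :
    ainner A x (z • y) = z • ainner A x y := by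
  simp [ainner]

theorem star_ainner (x y : X) : star (ainner A x y) = ainner A y x := by
  rw [ainner, ainner, ← CStarModule.star_inner (A := Aᵐᵒᵖ) x y, unop_star]

theorem ainner_self_nonneg (x : X) : 0 ≤ ainner A x x :=
  CStarModule.inner_self_nonneg (A := Aᵐᵒᵖ) (x := x)

theorem ainner_self_eq_zero (x : X) : ainner A x x = 0 ↔ x = 0 := by
  rw [ainner, unop_eq_zero_iff, CStarModule.inner_self]

theorem norm_eq_sqrt_norm_ainner (x : X) : ‖x‖ = √‖ainner A x x‖ :=
  CStarModule.norm_eq_sqrt_norm_inner_self (A := Aᵐᵒᵖ) x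

variable [StarOrderedRing A] in
/-- `|x|`, the positive square root of `⟨x, x⟩` in `A`. -/
noncomputable def modulus (x : X) : A := CFC.sqrt (ainner A x x)

variable (X) in
/-- `X` is self-dual: every bounded `A`-linear map `τ : X → A` is of the form `⟨z, ·⟩`. -/
def IsSelfDual : Prop :=
  ∀ τ : X →L[ℂ] A, (∀ (a : A) (x : X), τ (op a • x) = τ x * a) →
    ∃ z : X, ∀ x : X, τ x = ainner A z x

/-- The states of the unital C⋆-algebra `A`: positive linear functionals with value `1` at `1`. -/
def stateSet : Set (StrongDual ℂ A) :=
  {f | (∀ a : A, 0 ≤ a → 0 ≤ f a) ∧ f 1 = 1}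

/-- The pure states of `A`: the extreme points of the convex set of states. -/
def pureStates : Set (StrongDual ℂ A) := (stateSet A).extremePoints ℝ

variable {A}

/-- `B : X × Y → A` is a bounded `A`-sesquilinear form: biadditive, `A`-linear in the second
variable, conjugate `A`-linear in the first, and bounded. (As `A` is unital, complex
sesquilinearity follows by taking scalar multiples of `1`.) -/
structure IsBoundedSesquilinear (B : X → Y → A) : Prop where
  add_left : ∀ (x x' : X) (y : Y), B (x + x') y = B x y + B x' y
  add_right : ∀ (x : X) (y y' : Y), B x (y + y') = B x y + B x y'
  smul_left : ∀ (a : A) (x : X) (y : Y), B (op a • x) y = star a * B x y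
  smul_right : ∀ (a : A) (x : X) (y : Y), B x (op a • y) = B x y * a
  bounded : ∃ M : ℝ, ∀ (x : X) (y : Y), ‖B x y‖ ≤ M * ‖x‖ * ‖y‖

variable [StarOrderedRing A] in
/-- The two lower bounds, with constants `c` and `k`, imposed on `B` through the pure states.
The numbers `f |x|` and `f |y|` are real and nonnegative, so taking real parts loses nothing. -/
structure IsCoercive (B : X → Y → A) (c k : ℝ) : Prop where
  left : ∀ f ∈ pureStates A, ∀ x : X, ∃ y : Y, ‖y‖ = 1 ∧ k ≤ (f (modulus A y)).re ∧
    c * (f (modulus A x)).re * (f (modulus A y)).re ≤ ‖f (B x y)‖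
  right : ∀ f ∈ pureStates A, ∀ y : Y, ∃ x : X, ‖x‖ = 1 ∧ k ≤ (f (modulus A x)).re ∧
    c * (f (modulus A x)).re * (f (modulus A y)).re ≤ ‖f (B x y)‖

end Defs

end LaxMilgram

namespace LaxMilgram

/-! ### States, and pure states norming a positive element. -/

section States

variable {A : Type*} [CStarAlgebra A] [PartialOrder A] [StarOrderedRing A]

/-! Self-duality of `Y` and of `X` represents `B` as `⟨T x, y⟩` and as `⟨x, S y⟩`, so `T` and `S`
are mutually adjoint (`exists_representing_map`). Some pure state attains the norm of `|x|`
(`exists_pureState_apply_eq_norm`); coercivity at that state bounds `T` below by `c * k / 2`, and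
symmetrically `S`.

Since `⟨T x, T x⟩ ≤ ⟨T x, T x⟩ + t⟨x, x⟩`, the operators `S T + t` with `t ≥ 0` share one lower
bound. They are invertible for large `t`, and the uniform bound carries invertibility down to `t =
0` (`isUnit_of_forall_bounded_below`). With `S T` invertible and `S` injective, `T` is onto. -/

theorem norm_apply_le_of_isSelfAdjoint {f : StrongDual ℂ A} (hf : f ∈ stateSet A) {a : A}
    (ha : IsSelfAdjoint a) : ‖f a‖ ≤ ‖a‖ := by
  obtain ⟨hpos, hone⟩ := hf
  have hs (r : ℝ) : f (algebraMap ℝ A r) = r := by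
    rw [IsScalarTower.algebraMap_apply ℝ ℂ A, Algebra.algebraMap_eq_smul_one, map_smul, hone]
    simp
  have h1 := hpos _ (sub_nonneg.2 ha.le_algebraMap_norm_self)
  have h2 := hpos _ (sub_nonneg.2 ha.neg_algebraMap_norm_le_self)
  simp only [map_sub, sub_neg_eq_add, map_add, hs] at h1 h2
  rw [Complex.nonneg_iff] at h1 h2
  simp only [Complex.sub_re, Complex.add_re, Complex.sub_im, Complex.add_im, Complex.ofReal_re,
    Complex.ofReal_im] at h1 h2
  have him : (f a).im = 0 := by linarith [h2.2]
  have : f a = ((f a).re : ℂ) := Complex.ext rfl (by simpa using him)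
  rw [this, Complex.norm_real, Real.norm_eq_abs, abs_le]
  constructor <;> linarith [h1.1, h2.1]

/-- Splitting into real and imaginary parts costs the factor 2; the sharp constant 1 is not needed.
-/
theorem norm_apply_le_two_mul {f : StrongDual ℂ A} (hf : f ∈ stateSet A) (a : A) :
    ‖f a‖ ≤ 2 * ‖a‖ := by
  rw [← realPart_add_I_smul_imaginaryPart a, map_add, map_smul]
  have h1 := norm_apply_le_of_isSelfAdjoint hf (realPart a).2
  have h2 := norm_apply_le_of_isSelfAdjoint hf (imaginaryPart a).2
  have h3 := realPart.norm_le a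
  have h4 := imaginaryPart.norm_le a
  rw [realPart_add_I_smul_imaginaryPart a]
  refine (norm_add_le _ _).trans ?_
  rw [norm_smul, Complex.norm_I, one_mul]
  have h3' : ‖(realPart a : A)‖ ≤ ‖a‖ := h3
  have h4' : ‖(imaginaryPart a : A)‖ ≤ ‖a‖ := h4
  linarith

/-- A functional of norm at most one with `f 1 = 1` is a state. -/
theorem mem_stateSet_of_norm_le_one {f : StrongDual ℂ A} (hf : ‖f‖ ≤ 1) (h1 : f 1 = 1) :
    f ∈ stateSet A := by
  have hb (b : A) : ‖f b‖ ≤ ‖b‖ := by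
    simpa using f.le_of_opNorm_le hf b
  have him (a : A) (ha : IsSelfAdjoint a) : (f a).im = 0 := by
    by_contra hne
    -- Test on `a + it`: the left side has a term linear in `t`, the right side has none, so a
    -- suitable `t` gives a contradiction.
    have key (t : ℝ) : ((f a).im + t) ^ 2 ≤ ‖a‖ ^ 2 + t ^ 2 := by
      set b : A := a + (Complex.I * t) • (1 : A) with hbdef
      have hfb : f b = f a + Complex.I * t := by simp [b, h1]
      have hstar : star b * b = a * a + ((t ^ 2 : ℝ) : ℂ) • (1 : A) := by
        have : star b = a - (Complex.I * t) • (1 : A) := by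
          simp [b, ha.star_eq, sub_eq_add_neg]
        rw [this, hbdef, sub_mul, mul_add, mul_add]
        simp only [mul_smul_comm, smul_mul_assoc, mul_one, one_mul, smul_smul]
        have : Complex.I * (t : ℂ) * (Complex.I * t) = -((t ^ 2 : ℝ) : ℂ) := by
          push_cast
          linear_combination (t : ℂ) ^ 2 * Complex.I_sq
        rw [this, neg_smul]
        abel
      have hn : ‖b‖ ^ 2 ≤ ‖a‖ ^ 2 + t ^ 2 := by
        rcases subsingleton_or_nontrivial A
        · rw [Subsingleton.elim b 0, norm_zero, zero_pow two_ne_zero]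
          exact add_nonneg (sq_nonneg _) (sq_nonneg _)
        rw [sq, ← CStarRing.norm_star_mul_self, hstar]
        refine (norm_add_le _ _).trans ?_
        rw [norm_smul, Complex.norm_real, norm_one, mul_one, Real.norm_eq_abs,
          abs_of_nonneg (sq_nonneg t), sq ‖a‖]
        gcongr
        exact norm_mul_le _ _
      have him' : (f b).im = (f a).im + t := by simp [hfb]
      have : |(f b).im| ≤ ‖b‖ := (Complex.abs_im_le_norm _).trans (hb b)
      rw [him'] at this
      calc ((f a).im + t) ^ 2 = |(f a).im + t| ^ 2 := (sq_abs _).symm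
        _ ≤ ‖b‖ ^ 2 := by gcongr
        _ ≤ _ := hn
    have := key ((‖a‖ ^ 2 + 1) / (f a).im)
    have h2 : (f a).im * ((‖a‖ ^ 2 + 1) / (f a).im) = ‖a‖ ^ 2 + 1 := by field_simp
    nlinarith [sq_nonneg (f a).im, sq_nonneg ‖a‖]
  refine ⟨fun a ha => ?_, h1⟩
  rw [Complex.nonneg_iff]
  refine ⟨?_, (him a (IsSelfAdjoint.of_nonneg ha)).symm⟩
  have hle : ‖algebraMap ℝ A ‖a‖ - a‖ ≤ ‖a‖ := by
    have h0 : 0 ≤ algebraMap ℝ A ‖a‖ - a :=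
      sub_nonneg.2 (IsSelfAdjoint.of_nonneg ha).le_algebraMap_norm_self
    rw [CStarAlgebra.norm_le_iff_le_algebraMap _ (norm_nonneg a) h0]
    exact sub_le_self _ ha
  have hs : f (algebraMap ℝ A ‖a‖) = (‖a‖ : ℝ) := by
    rw [IsScalarTower.algebraMap_apply ℝ ℂ A, Algebra.algebraMap_eq_smul_one, map_smul, h1]
    simp
  have h3 := ((Complex.abs_re_le_norm _).trans (hb _)).trans hle
  rw [map_sub, hs, Complex.sub_re, Complex.ofReal_re] at h3
  linarith [(abs_le.1 h3).2]

/-- As `‖a‖` lies in the spectrum, `‖1 + a‖ = 1 + ‖a‖`. A Hahn–Banach functional norming `1 + a`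
must then attain its bound at both `1` and `a`. -/
theorem exists_state_apply_eq_norm [Nontrivial A] {a : A} (ha : 0 ≤ a) :
    ∃ f ∈ stateSet A, f a = (‖a‖ : ℂ) := by
  have hnorm : ‖1 + a‖ = 1 + ‖a‖ := by
    refine le_antisymm ((norm_add_le _ _).trans (by simp)) ?_
    have h := CStarAlgebra.norm_mem_spectrum_of_nonneg ha
    have h' : 1 + ‖a‖ ∈ spectrum ℝ (1 + a) := by
      have := spectrum.add_mem_add_iff (R := ℝ) (a := a) (r := ‖a‖) (s := 1)
      rw [map_one] at this
      rw [add_comm 1 ‖a‖]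
      exact this.2 h
    exact (le_abs_self _).trans (by simpa using spectrum.norm_le_norm_of_mem h')
  obtain ⟨f, hf, hfa⟩ := exists_dual_vector'' ℂ (1 + a)
  have hb (b : A) : ‖f b‖ ≤ ‖b‖ := by simpa using f.le_of_opNorm_le hf b
  have h1 : ‖f 1‖ ≤ 1 := by simpa using hb 1
  have hsum : f 1 + f a = 1 + (‖a‖ : ℂ) := by
    rw [← map_add, hfa, hnorm]
    push_cast
    rfl
  have eqn {z : ℂ} {r : ℝ} (h : ‖z‖ ≤ r) (h' : r ≤ z.re) : z = r := by
    have h2 : z.re = ‖z‖ := le_antisymm (Complex.re_le_norm z) (h.trans h')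
    have h3 : z.re = r := le_antisymm (h2.le.trans h) h'
    have h4 := Complex.sq_norm z
    rw [Complex.normSq_apply, ← h2] at h4
    refine Complex.ext (by simpa using h3) ?_
    have : z.im * z.im = 0 := by linarith [sq z.re]
    simpa using this
  have hre := congrArg Complex.re hsum
  simp only [Complex.add_re, Complex.one_re, Complex.ofReal_re] at hre
  have r1 := (Complex.re_le_norm _).trans h1
  have r2 := (Complex.re_le_norm _).trans (hb a)
  refine ⟨f, mem_stateSet_of_norm_le_one hf ?_, eqn (hb a) (by linarith)⟩
  simpa using eqn h1 (by linarith)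

theorem isCompact_toWeakDual_image_stateSet :
    IsCompact (StrongDual.toWeakDual '' stateSet A) := by
  have himage : (StrongDual.toWeakDual '' stateSet A) =
      {g : WeakDual ℂ A | (∀ a : A, 0 ≤ a → 0 ≤ g a) ∧ g 1 = 1} := by
    ext g
    constructor
    · rintro ⟨f, hf, rfl⟩
      exact hf
    · intro hg
      exact ⟨WeakDual.toStrongDual g, hg, rfl⟩
  refine (WeakDual.isCompact_closedBall (0 : StrongDual ℂ A) 2).of_isClosed_subset ?_ ?_
  · rw [himage]
    have hpos : IsClosed (⋂ (a : A) (_ : 0 ≤ a), {g : WeakDual ℂ A | 0 ≤ g a}) :=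
      isClosed_iInter fun a => isClosed_iInter fun _ =>
        isClosed_le continuous_const (WeakDual.eval_continuous a)
    convert hpos.inter (isClosed_eq (WeakDual.eval_continuous (1 : A))
      (continuous_const (y := (1 : ℂ)))) using 1
    ext g
    simp
  · rintro _ ⟨f, hf, rfl⟩
    simpa using f.opNorm_le_bound zero_le_two (norm_apply_le_two_mul hf)

/-- Pure states attain the norm of a positive element. -/
theorem exists_pureState_apply_eq_norm [Nontrivial A] {a : A} (ha : 0 ≤ a) :
    ∃ f ∈ pureStates A, f a = (‖a‖ : ℂ) := by
  set K : Set (WeakDual ℂ A) := StrongDual.toWeakDual '' stateSet A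
  -- `F` is a weak-* compact face of the states: Krein–Milman gives it an extreme point, which is
  -- extreme in `K` too.
  set F : Set (WeakDual ℂ A) := {g ∈ K | g a = (‖a‖ : ℂ)}
  have hFcomp : IsCompact F := isCompact_toWeakDual_image_stateSet.inter_right
    (isClosed_eq (WeakDual.eval_continuous a) continuous_const)
  have hFne : F.Nonempty := by
    obtain ⟨f, hf, hfa⟩ := exists_state_apply_eq_norm ha
    exact ⟨StrongDual.toWeakDual f, ⟨f, hf, rfl⟩, hfa⟩
  have : IsScalarTower ℝ ℂ (WeakDual ℂ A) := inferInstanceAs (IsScalarTower ℝ ℂ (A →L[ℂ] ℂ))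
  have : LocallyConvexSpace ℝ (WeakDual ℂ A) := 
    (WeakDual.withSeminorms (𝕜 := ℂ) (E := A)).toLocallyConvexSpace
  obtain ⟨g, hg⟩ := hFcomp.extremePoints_nonempty hFne
  have hre {h : WeakDual ℂ A} (hh : h ∈ K) : (h a).re ≤ ‖a‖ := by
    obtain ⟨f, hf, rfl⟩ := hh
    exact (Complex.re_le_norm _).trans
      (norm_apply_le_of_isSelfAdjoint hf (IsSelfAdjoint.of_nonneg ha))
  have himz {h : WeakDual ℂ A} (hh : h ∈ K) (hr : (h a).re = ‖a‖) : h ∈ F := by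
    refine ⟨hh, Complex.ext hr ?_⟩
    obtain ⟨f, hf, rfl⟩ := hh
    exact (Complex.nonneg_iff.1 (hf.1 a ha)).2.symm
  have hext : IsExtreme ℝ K F := by
    refine ⟨fun g hg => hg.1, ?_⟩
    rintro g₁ hg₁ g₂ hg₂ g hg ⟨s, t, hs, ht, hst, rfl⟩
    refine himz hg₁ ?_
    have h := congrArg Complex.re hg.2
    have h1 := hre hg₁
    have h2 := hre hg₂
    have e : ((s • g₁ + t • g₂ : WeakDual ℂ A) a).re = s * (g₁ a).re + t * (g₂ a).re := by
      change (s • g₁ a + t • g₂ a).re = _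
      simp
    rw [e, Complex.ofReal_re] at h
    by_contra hne
    have hlt := lt_of_le_of_ne h1 hne
    have hsum : s * ‖a‖ + t * ‖a‖ = ‖a‖ := by rw [← add_mul, hst, one_mul]
    linarith [mul_lt_mul_of_pos_left hlt hs, mul_le_mul_of_nonneg_left h2 ht.le]
  have hgK := hext.extremePoints_subset_extremePoints hg
  have himg := image_extremePoints
    ((StrongDual.toWeakDual : StrongDual ℂ A ≃ₗ[ℂ] WeakDual ℂ A).restrictScalars ℝ) (stateSet A)
  have : g ∈ StrongDual.toWeakDual '' (stateSet A).extremePoints ℝ := by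
    have h2 := himg.symm.subset hgK
    exact h2
  obtain ⟨f, hf, rfl⟩ := this
  exact ⟨f, hf, hg.1.2⟩

end States

/-! ### Hilbert modules and Riesz representation. -/

section Modules

variable {A : Type*} [CStarAlgebra A] [PartialOrder A]
variable {X : Type*} [NormedAddCommGroup X] [NormedSpace ℂ X] [Module Aᵐᵒᵖ X] [CStarModule Aᵐᵒᵖ X]

theorem norm_sq_eq_norm_ainner (x : X) : ‖x‖ ^ 2 = ‖ainner A x x‖ :=
  CStarModule.norm_sq_eq Aᵐᵒᵖ

theorem ext_ainner {x x' : X} (h : ∀ y : X, ainner A x y = ainner A x' y) : x = x' := by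
  have h0 : ainner A (x - x') (x - x') = 0 := by
    have := h (x - x')
    simp only [ainner, unop_inj] at this
    rw [ainner, CStarModule.inner_sub_left, this, sub_self, unop_zero]
  exact sub_eq_zero.1 ((ainner_self_eq_zero A _).1 h0)

theorem ainner_add_left (x x' y : X) : ainner A (x + x') y = ainner A x y + ainner A x' y := by
  simp [ainner]

theorem ainner_smul_left (a : A) (x y : X) : ainner A (op a • x) y = star a * ainner A x y := by
  simp [ainner]

theorem ainner_smul_left_complex (z : ℂ) (x y : X) :
    ainner A (z • x) y = star z • ainner A x y := by
  simp [ainner]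

theorem complex_smul_eq (z : ℂ) (x : X) : z • x = op (algebraMap ℂ A z) • x := by
  refine ext_ainner (A := A) fun y => ?_
  rw [ainner_smul_left_complex, ainner_smul_left, ← algebraMap_star_comm, Algebra.smul_def]

theorem subsingleton_of_subsingleton [Subsingleton A] : Subsingleton X :=
  ⟨fun _ _ => ext_ainner (A := A) fun _ => Subsingleton.elim _ _⟩

theorem IsBoundedSesquilinear.flip {A X Y : Type*} [CStarAlgebra A]
    [NormedAddCommGroup X] [Module Aᵐᵒᵖ X] [NormedAddCommGroup Y] [Module Aᵐᵒᵖ Y] {B : X → Y → A} (hB : IsBoundedSesquilinear B) :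
    IsBoundedSesquilinear fun y x => star (B x y) where
  add_left y y' x := by rw [hB.add_right, star_add]
  add_right y x x' := by rw [hB.add_left, star_add]
  smul_left a y x := by rw [hB.smul_right, star_mul]
  smul_right a y x := by rw [hB.smul_left, star_mul, star_star]
  bounded := by
    obtain ⟨M, hM⟩ := hB.bounded
    refine ⟨M, fun y x => ?_⟩
    rw [norm_star, mul_right_comm]
    exact hM x y

/-- Riesz representation of a bounded sesquilinear form on a self-dual module. -/
theorem exists_representing_map {Y : Type*} [NormedAddCommGroup Y] [NormedSpace ℂ Y]
    [Module Aᵐᵒᵖ Y] [CStarModule Aᵐᵒᵖ Y] (hY : IsSelfDual A Y) {B : X → Y → A}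
    (hB : IsBoundedSesquilinear B) :
    ∃ T : X →L[ℂ] Y, (∀ (a : A) (x : X), T (op a • x) = op a • T x) ∧
      ∀ x y, B x y = ainner A (T x) y := by
  obtain ⟨M, hM⟩ := hB.bounded
  have hex (x : X) : ∃ z : Y, ∀ y, B x y = ainner A z y := by
    refine hY (LinearMap.mkContinuous
      { toFun := B x
        map_add' := hB.add_right x
        map_smul' := fun z y => ?_ } (M * ‖x‖) (hM x)) fun a y => hB.smul_right a x y
    rw [complex_smul_eq (A := A), hB.smul_right, RingHom.id_apply, Algebra.smul_def,
      Algebra.commutes]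
  choose T hT using hex
  have hsmul (a : A) (x : X) : T (op a • x) = op a • T x :=
    ext_ainner (A := A) fun y => by rw [← hT, hB.smul_left, hT, ainner_smul_left]
  refine ⟨LinearMap.mkContinuous
    { toFun := T
      map_add' := fun x x' => ext_ainner (A := A) fun y => by
        rw [← hT, hB.add_left, ainner_add_left, hT, hT]
      map_smul' := fun z x => by
        rw [complex_smul_eq (A := A), hsmul, RingHom.id_apply, ← complex_smul_eq] } |M| ?_,
    hsmul, hT⟩
  intro x
  change ‖T x‖ ≤ |M| * ‖x‖
  -- Test the form at `y = T x` and cancel one factor `‖T x‖`.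
  rcases (norm_nonneg (T x)).eq_or_lt with h0 | hpos
  · rw [← h0]
    positivity
  · refine le_of_mul_le_mul_right ?_ hpos
    calc ‖T x‖ * ‖T x‖ = ‖B x (T x)‖ := by
          rw [← sq, norm_sq_eq_norm_ainner (A := A), hT]
      _ ≤ M * ‖x‖ * ‖T x‖ := hM _ _
      _ ≤ |M| * ‖x‖ * ‖T x‖ := by gcongr; exact le_abs_self M

end Modules

/-! ### From pure states to norm bounds. -/

section Bounds

variable {A : Type*} [CStarAlgebra A] [PartialOrder A] [StarOrderedRing A]
variable {X Y : Type*}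
  [NormedAddCommGroup X] [NormedSpace ℂ X] [Module Aᵐᵒᵖ X] [CStarModule Aᵐᵒᵖ X]
  [NormedAddCommGroup Y] [NormedSpace ℂ Y] [Module Aᵐᵒᵖ Y] [CStarModule Aᵐᵒᵖ Y]

theorem norm_ainner_le (x y : X) : ‖ainner A x y‖ ≤ ‖x‖ * ‖y‖ :=
  CStarModule.norm_inner_le (A := Aᵐᵒᵖ) X

theorem norm_modulus (x : X) : ‖modulus A x‖ = ‖x‖ := by
  have h : star (modulus A x) = modulus A x :=
    (IsSelfAdjoint.of_nonneg (CFC.sqrt_nonneg (ainner A x x))).star_eq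
  have hsq : modulus A x * modulus A x = ainner A x x :=
    CFC.sqrt_mul_sqrt_self _ (ainner_self_nonneg A x)
  rw [← sq_eq_sq₀ (norm_nonneg _) (norm_nonneg _), norm_sq_eq_norm_ainner (A := A) x, sq,
    ← CStarRing.norm_star_mul_self, h, hsq]

/-- A lower bound through pure states passes to a lower bound in norm. -/
theorem exists_mul_norm_le_norm {c k : ℝ} (hc : 0 ≤ c) {b : Y → A} {x : X}
    (h : ∀ f ∈ pureStates A, ∃ y : Y, ‖y‖ = 1 ∧ k ≤ (f (modulus A y)).re ∧
      c * (f (modulus A x)).re * (f (modulus A y)).re ≤ ‖f (b y)‖) :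
    ∃ y : Y, ‖y‖ ≤ 1 ∧ c * k * ‖x‖ ≤ 2 * ‖b y‖ := by
  -- The zero algebra has no states, so it is treated apart.
  cases subsingleton_or_nontrivial A
  · have := subsingleton_of_subsingleton (A := A) (X := X)
    refine ⟨0, by simp, ?_⟩
    rw [Subsingleton.elim x 0]
    simp
  have hpos : 0 ≤ modulus A x := CFC.sqrt_nonneg _
  obtain ⟨f, hf, hfx⟩ := exists_pureState_apply_eq_norm hpos
  obtain ⟨y, hy, hk, hle⟩ := h f hf
  refine ⟨y, hy.le, le_trans ?_ (hle.trans (norm_apply_le_two_mul hf.1 _))⟩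
  rw [hfx, norm_modulus, Complex.ofReal_re]
  calc c * k * ‖x‖ = c * ‖x‖ * k := by ring
    _ ≤ _ := by gcongr

end Bounds

/-! ### Invertibility by continuation. -/

section Invertibility

/-- If `R + t` is bounded below uniformly in `t ≥ 0`, then `R` is invertible. -/
theorem isUnit_of_forall_bounded_below {E : Type*} [NormedAddCommGroup E] [NormedSpace ℂ E]
    [CompleteSpace E] (R : E →L[ℂ] E) {m : ℝ} (hm : 0 < m)
    (h : ∀ t : ℝ, 0 ≤ t → ∀ x, m * ‖x‖ ≤ ‖R x + (t : ℂ) • x‖) : IsUnit R := by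
  -- Descend from `t ≥ ‖R‖ + 1` (Neumann series) in steps of `m / 2`: inverses have norm at most
  -- `m⁻¹`, so each step is a perturbation of relative size below 1.
  have key (n : ℕ) : ∀ t : ℝ, 0 ≤ t → ‖R‖ + 1 ≤ t + n * (m / 2) →
      IsUnit (R + (t : ℂ) • (1 : E →L[ℂ] E)) := by
    induction n with
    | zero =>
      intro t ht hle
      have ht' : 0 < t := by
        have := norm_nonneg R
        simp only [CharP.cast_eq_zero, zero_mul, add_zero] at hle
        linarith
      have htne : (t : ℂ) ≠ 0 := by exact_mod_cast ht'.ne'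
      have hlt : ‖-((t : ℂ)⁻¹ • R)‖ < 1 := by
        rw [norm_neg, norm_smul, norm_inv, Complex.norm_real, Real.norm_eq_abs, abs_of_pos ht',
          inv_mul_lt_iff₀ ht']
        simp only [CharP.cast_eq_zero, zero_mul, add_zero] at hle
        linarith
      have hu := (isUnit_one_sub_of_norm_lt_one hlt).smul (Units.mk0 (t : ℂ) htne)
      convert hu using 1
      simp [Units.smul_def, smul_smul, htne, add_comm]
    | succ n ih =>
      intro t ht hle
      have hpos : 0 ≤ t + m / 2 := by positivity
      obtain ⟨u, hu⟩ := ih (t + m / 2) hpos (by push_cast at hle; linarith)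
      have hinv : ‖(↑u⁻¹ : E →L[ℂ] E)‖ ≤ m⁻¹ := by
        refine ContinuousLinearMap.opNorm_le_bound _ (by positivity) fun x => ?_
        have h1 := h _ hpos ((↑u⁻¹ : E →L[ℂ] E) x)
        have h2 : (u : E →L[ℂ] E) ((↑u⁻¹ : E →L[ℂ] E) x) = x := by
          rw [← mul_apply_eq_comp, Units.mul_inv, one_apply_eq_self]
        rw [hu] at h2
        simp only [add_apply, smul_apply,
          one_apply_eq_self] at h2
        rw [h2] at h1
        rwa [inv_mul_eq_div, le_div_iff₀' hm]
      have hlt : ‖((m / 2 : ℝ) : ℂ) • (↑u⁻¹ : E →L[ℂ] E)‖ < 1 := by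
        rw [norm_smul, Complex.norm_real, Real.norm_eq_abs, abs_of_pos (by positivity)]
        calc m / 2 * ‖(↑u⁻¹ : E →L[ℂ] E)‖ ≤ m / 2 * m⁻¹ := by gcongr
          _ < 1 := by field_simp; norm_num
      have hprod := u.isUnit.mul (isUnit_one_sub_of_norm_lt_one hlt)
      convert hprod using 1
      rw [mul_sub, mul_smul_comm, Units.mul_inv, hu, mul_one]
      push_cast
      module
  obtain ⟨n, hn⟩ := exists_nat_ge ((‖R‖ + 1) / (m / 2))
  have := key n 0 le_rfl (by rw [div_le_iff₀ (by positivity)] at hn; linarith)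
  simpa using this

theorem injective_of_bounded_below {E F : Type*} [NormedAddCommGroup E] [NormedSpace ℂ E]
    [NormedAddCommGroup F] [NormedSpace ℂ F] {L : E →L[ℂ] F} {m : ℝ} (hm : 0 < m)
    (h : ∀ x, m * ‖x‖ ≤ ‖L x‖) : Function.Injective L := by
  refine (injective_iff_map_eq_zero L).2 fun x hx => ?_
  have := h x
  rw [hx, norm_zero] at this
  exact norm_le_zero_iff.1 (nonpos_of_mul_nonpos_right this hm)

end Invertibility

/-! ### Bijectivity from two lower bounds. -/

section Adjointable

variable {A : Type*} [CStarAlgebra A] [PartialOrder A] [StarOrderedRing A]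
variable {X Y : Type*}
  [NormedAddCommGroup X] [NormedSpace ℂ X] [Module Aᵐᵒᵖ X] [CStarModule Aᵐᵒᵖ X]
  [NormedAddCommGroup Y] [NormedSpace ℂ Y] [Module Aᵐᵒᵖ Y] [CStarModule Aᵐᵒᵖ Y]

/-- An adjointable operator that is bounded below together with its adjoint is bijective. -/
theorem bijective_of_bounded_below [CompleteSpace X] {T : X →L[ℂ] Y} {S : Y →L[ℂ] X}
    (hadj : ∀ x y, ainner A (T x) y = ainner A x (S y)) {m : ℝ} (hm : 0 < m)
    (hT : ∀ x, m * ‖x‖ ≤ ‖T x‖) (hS : ∀ y, m * ‖y‖ ≤ ‖S y‖) : Function.Bijective T := by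
  have hunit : IsUnit (S ∘L T) := by
    refine isUnit_of_forall_bounded_below _ (pow_pos hm 2) fun t ht x => ?_
    rcases (norm_nonneg x).eq_or_lt with h0 | hpos
    · rw [← h0, mul_zero]
      exact norm_nonneg _
    refine le_of_mul_le_mul_left ?_ hpos
    calc ‖x‖ * (m ^ 2 * ‖x‖) = (m * ‖x‖) ^ 2 := by ring
      _ ≤ ‖T x‖ ^ 2 := by gcongr; exact hT x
      _ = ‖ainner A (T x) (T x)‖ := norm_sq_eq_norm_ainner _
      _ ≤ ‖ainner A (T x) (T x) + (t : ℂ) • ainner A x x‖ := by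
        refine CStarAlgebra.norm_le_norm_of_nonneg_of_le (ainner_self_nonneg A _) ?_
        refine le_add_of_nonneg_right ?_
        rw [Complex.coe_smul]
        exact smul_nonneg ht (ainner_self_nonneg A x)
      _ = ‖ainner A x ((S ∘L T) x + (t : ℂ) • x)‖ := by
        rw [ainner_add_right, ainner_smul_right_complex, hadj, ContinuousLinearMap.comp_apply]
      _ ≤ _ := norm_ainner_le _ _
  obtain ⟨u, hu⟩ := hunit
  -- At `x = S y`, injectivity of `S` makes `u⁻¹ (S y)` a preimage of `y` under `T`.
  have hsurj (x : X) : S (T ((↑u⁻¹ : X →L[ℂ] X) x)) = x := by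
    rw [← ContinuousLinearMap.comp_apply, ← hu, ← mul_apply_eq_comp, Units.mul_inv,
      one_apply_eq_self]
  exact ⟨injective_of_bounded_below hm hT, fun y => ⟨(↑u⁻¹ : X →L[ℂ] X) (S y), injective_of_bounded_below hm hS (hsurj _)⟩⟩

end Adjointable

end LaxMilgram

/-! ### The Lax–Milgram theorem. -/

theorem corollary2p5
    {A : Type*} [CStarAlgebra A] [PartialOrder A] [StarOrderedRing A] [WStarAlgebra A]
    {X : Type*} [NormedAddCommGroup X] [NormedSpace ℂ X] [CompleteSpace X]
    [Module Aᵐᵒᵖ X] [CStarModule Aᵐᵒᵖ X]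
    {Y : Type*} [NormedAddCommGroup Y] [NormedSpace ℂ Y] [CompleteSpace Y]
    [Module Aᵐᵒᵖ Y] [CStarModule Aᵐᵒᵖ Y]
    (hX : LaxMilgram.IsSelfDual A X) (hY : LaxMilgram.IsSelfDual A Y)
    (B : X → Y → A) (hB : LaxMilgram.IsBoundedSesquilinear B)
    (hcoercive : ∃ c > (0 : ℝ), ∃ k > (0 : ℝ), LaxMilgram.IsCoercive B c k) :
    ∃ T : X ≃L[ℂ] Y,
      (∀ (a : A) (x : X), T (MulOpposite.op a • x) = MulOpposite.op a • T x) ∧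
      (∃ S : Y →L[ℂ] X,
        (∀ (a : A) (y : Y), S (MulOpposite.op a • y) = MulOpposite.op a • S y) ∧
        ∀ (x : X) (y : Y), LaxMilgram.ainner A (T x) y = LaxMilgram.ainner A x (S y)) ∧
      ∀ (x : X) (y : Y), B x y = LaxMilgram.ainner A (T x) y := by
  obtain ⟨c, hc, k, hk, hBc⟩ := hcoercive
  obtain ⟨T, hTA, hT⟩ := LaxMilgram.exists_representing_map hY hB
  obtain ⟨S, hSA, hS⟩ := LaxMilgram.exists_representing_map hX hB.flip
  have hS' (x : X) (y : Y) : B x y = LaxMilgram.ainner A x (S y) := by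
    rw [← LaxMilgram.star_ainner, ← hS, star_star]
  have hTb (x : X) : c * k / 2 * ‖x‖ ≤ ‖T x‖ := by
    obtain ⟨y, hy, hle⟩ := LaxMilgram.exists_mul_norm_le_norm hc.le
      fun f hf => hBc.left f hf x
    rw [hT] at hle
    have h1 := LaxMilgram.norm_ainner_le (A := A) (T x) y
    have h2 := mul_le_of_le_one_right (norm_nonneg (T x)) hy
    linarith
  have hSb (y : Y) : c * k / 2 * ‖y‖ ≤ ‖S y‖ := by
    obtain ⟨x, hx, hle⟩ := LaxMilgram.exists_mul_norm_le_norm (X := Y) (Y := X) (x := y)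
      (b := fun x => B x y) (k := k) hc.le fun f hf => by
        obtain ⟨x, h1, h2, h3⟩ := hBc.right f hf y
        exact ⟨x, h1, h2, by rwa [mul_right_comm]⟩
    rw [hS'] at hle
    have h1 := LaxMilgram.norm_ainner_le (A := A) x (S y)
    have h2 := mul_le_of_le_one_left (norm_nonneg (S y)) hx
    linarith
  have hadj (x : X) (y : Y) : LaxMilgram.ainner A (T x) y = LaxMilgram.ainner A x (S y) := by
    rw [← hT, hS']
  have hbij := LaxMilgram.bijective_of_bounded_below hadj (by positivity) hTb hSb
  exact ⟨ContinuousLinearEquiv.ofBijective T (LinearMap.ker_eq_bot.2 hbij.1)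
    (LinearMap.range_eq_top.2 hbij.2), hTA, ⟨S, hSA, hadj⟩, hT⟩
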